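/- Let $E$ be a Banach space over $\mathbb K\in\{\mathbb R,\mathbb C\}$, let $\Lambda\subset E$ be open, let $x_0\in\Lambda$, and let $\mathcal F=\{M(x)\}_{x\in\Lambda}$ be a family of linear subspaces of $E$, possibly infinite-dimensional. Definitions. The notation $E=A\oplus B$ means that $A,B$ are closed subspaces with $A\cap B=\{0\}$ and $A+B=E$; then $P_A^{B}$ denotes the projection of $E$ onto $A$ along $B$. A set $S\subset E$ is a $c^1$ submanifold if for each $x\in S$ there are a decomposition $E=E_0\oplus E_1$, an open neighbourhood $U$ of $x$ in $E$ and a $c^1$ diffeomorphism $\varphi$ of $U$ onto an open set $\varphi(U)\subset E$ such that $\varphi(S\cap U)$ is an open subset of $E_0$. The family $\mathcal F$ is $c^1$ integrable at $x_0$ if there is a $c^1$ submanifold $S\subset\Lambda$ of $E$ with $x_0\in S$ that is tangent to $M(x)$ at every $x\in S$, that is, $$M(x)=\{\dot c(0): c \text{ is a } c^1\text{ curve in } S,\ \text{defined on an open interval around } 0,\ \text{with } c(0)=x\}\qquad\text{for all }x\in S.$$ Write $M_0=M(x_0)$. If $E=M_0\oplus E_*$, the co-final set is $J(x_0,E_*)=\{x\in\Lambda: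 M(x)\oplus E_*=E\}$, and for $x\in J(x_0,E_*)$ the coordinate operator $\alpha(x)$ is the unique bounded operator $\alpha(x)\in B(M_0,E_*)$ with $M(x)=\{e+\alpha(x)e: e\in M_0\}$. Differentiability is in the Fréchet sense over $\mathbb K$, curves have a real parameter, and $B(M_0,E_*)$ carries the operator norm. Theorem 2.2 (Frobenius theorem). $\mathcal F$ is $c^1$ integrable at $x_0$ if and only if the following conditions hold: (i) $M_0$ splits in $E$, say $E=M_0\oplus E_*$ for some closed subspace $E_*$; (ii) for such an $E_*$ there are an open neighbourhood $V$ of $P_{M_0}^{E_*}x_0$ in $M_0$ and a $c^1$ map $\psi:V\to E_*$ such that $x+\psi(x)\in J(x_0,E_*)$ for all $x\in V$ and the map $x\mapsto\alpha(x+\psi(x))\in B(M_0,E_*)$ is continuous on $V$; (iii) $\psi$ satisfies $$\psi'(x)=\alpha(x+\psi(x))\quad\text{for all }x\in V,\qquad \psi(P_{M_0}^{E_*}x_0)=P_{E_*}^{M_0}x_0 .$$ Here (i)–(iii) are required jointly: there exist $E_*$, $V$ and $\psi$ with all these properties. -/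

import Mathlib

open Set

/-! Direct sums `p ⊕ q = E` of subspaces of a Banach space are topological direct sums,
`Submodule.IsTopCompl p q`; in a Banach space this says exactly that `p`, `q` are closed and
algebraically complementary (`Submodule.isTopCompl_iff_isCompl_isClosed`). -/

section Submanifolds

variable (𝕜 : Type*) [RCLike 𝕜] {E : Type*} [NormedAddCommGroup E] [NormedSpace 𝕜 E]

/-- `S` is a `C¹` submanifold of `E`: around each of its points there is a `C¹` diffeomorphism `φ`
between open subsets of `E` mapping the part of `S` in its domain onto an open subset of a
subspace `E₀` that splits in `E`. -/
def IsC1Submanifold (S : Set E) : Prop :=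
  ∀ x ∈ S, ∃ E₀ E₁ : Submodule 𝕜 E, E₀.IsTopCompl E₁ ∧
    ∃ φ : OpenPartialHomeomorph E E, x ∈ φ.source ∧
      ContDiffOn 𝕜 1 φ φ.source ∧ ContDiffOn 𝕜 1 φ.symm φ.target ∧
      ∃ W : Set E₀, IsOpen W ∧ φ '' (S ∩ φ.source) = (fun w : E₀ => (w : E)) '' W

/-- The set of velocities `c'(0)` of `C¹` curves `c` in `S` with `c(0) = x`. -/
def tangentVectors {E : Type*} [NormedAddCommGroup E] [NormedSpace ℝ E]
    (S : Set E) (x : E) : Set E :=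
  {v | ∃ c : ℝ → E, ∃ δ : ℝ, 0 < δ ∧ ContDiffOn ℝ 1 c (Ioo (-δ) δ) ∧
    (∀ t ∈ Ioo (-δ) δ, c t ∈ S) ∧ c 0 = x ∧ HasDerivAt c v 0}

/-- The family `M(x)`, `x ∈ Λ`, is `C¹` integrable at `x₀`: there is a `C¹` submanifold `S ⊆ Λ`
through `x₀` that is tangent to `M(x)` at each of its points `x`.
Only the values of `M` on `Λ` matter. -/
def C1IntegrableAt [NormedSpace ℝ E] (Λ : Set E) (M : E → Submodule 𝕜 E) (x₀ : E) : Prop :=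
  ∃ S : Set E, x₀ ∈ S ∧ S ⊆ Λ ∧ IsC1Submanifold 𝕜 S ∧
    ∀ x ∈ S, (M x : Set E) = tangentVectors S x

end Submanifolds

section Cofinal

variable {𝕜 : Type*} [RCLike 𝕜] {E : Type*} [NormedAddCommGroup E] [NormedSpace 𝕜 E]

/-- The co-final set `J(x₀, Es) = {x ∈ Λ : M(x) ⊕ Es = E}`
(used for a closed complement `Es` of `M(x₀)`). -/
def cofinalSet (Λ : Set E) (M : E → Submodule 𝕜 E) (Es : Submodule 𝕜 E) : Set E :=
  {x | x ∈ Λ ∧ (M x).IsTopCompl Es}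

/-- `α ∈ B(M₀, Es)` is the coordinate operator of `N`, i.e. `N = {e + α e : e ∈ M₀}`. -/
def IsCoordinateOperator (M₀ Es N : Submodule 𝕜 E) (α : M₀ →L[𝕜] Es) : Prop :=
  (N : Set E) = {v | ∃ e : M₀, v = (e : E) + (α e : E)}

/-- A common complement `Es` of `M₀` and `N` gives a unique coordinate operator of `N`. -/
theorem existsUnique_coordinateOperator {M₀ Es N : Submodule 𝕜 E}
    (h₀ : M₀.IsTopCompl Es) (h : N.IsTopCompl Es) :
    ∃! α : M₀ →L[𝕜] Es, IsCoordinateOperator M₀ Es N α := by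
  have key : ∀ (p : Submodule 𝕜 E) (hp : p.IsTopCompl Es) (v : E),
      (p.projectionOntoL Es hp v : E) + (Es.projectionOntoL p hp.symm v : E) = v := by
    intro p hp v
    simpa using Submodule.projection_add_projection_eq_self hp.isCompl v
  have disj : ∀ a ∈ M₀, ∀ b ∈ Es, ∀ a' ∈ M₀, ∀ b' ∈ Es, a + b = a' + b' → a = a' ∧ b = b' := by
    intro a ha b hb a' ha' b' hb' hab
    have h1 : a - a' = b' - b := by
      rw [sub_eq_sub_iff_add_eq_add, hab, add_comm]
    have h2 : a - a' ∈ Es := h1 ▸ Es.sub_mem hb' hb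
    have h3 : a - a' = 0 :=
      Submodule.disjoint_def.1 h₀.isCompl.disjoint _ (M₀.sub_mem ha ha') h2
    refine ⟨sub_eq_zero.1 h3, ?_⟩
    rw [h3] at h1
    exact (sub_eq_zero.1 h1.symm).symm
  refine ⟨-((Es.projectionOntoL N h.symm).comp M₀.subtypeL), ?_, ?_⟩
  · ext v
    simp only [SetLike.mem_coe, Set.mem_ofPred_eq]
    constructor
    · intro hv
      refine ⟨M₀.projectionOntoL Es h₀ v, ?_⟩
      have e1 := key M₀ h₀ v
      have e2 : Es.projectionOntoL N h.symm (M₀.projectionOntoL Es h₀ v : E)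
          = -(Es.projectionOntoL M₀ h₀.symm v) := by
        have : (M₀.projectionOntoL Es h₀ v : E) = v - (Es.projectionOntoL M₀ h₀.symm v : E) :=
          eq_sub_of_add_eq e1
        rw [this, map_sub, Submodule.projectionOntoL_apply_left,
          (Submodule.projectionOntoL_apply_eq_zero_iff h.symm).2 hv, zero_sub]
      simp only [neg_apply, ContinuousLinearMap.comp_apply,
        Submodule.subtypeL_apply, e2, neg_neg]
      exact e1.symm
    · rintro ⟨e, rfl⟩
      have e1 := key N h (e : E)
      have : (e : E) + ((-((Es.projectionOntoL N h.symm).comp M₀.subtypeL)) e : Es)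
          = (N.projectionOntoL Es h (e : E) : E) := by
        simp only [neg_apply, ContinuousLinearMap.comp_apply,
          Submodule.subtypeL_apply, Submodule.coe_neg]
        rw [← sub_eq_add_neg]
        exact sub_eq_of_eq_add e1.symm
      rw [this]
      exact Subtype.property _
  · intro β hβ
    ext e
    have hmem : (e : E) + (β e : E) ∈ N := by
      have : (e : E) + (β e : E) ∈ (N : Set E) := by
        rw [hβ]; exact ⟨e, rfl⟩
      exact this
    have h0 := (Submodule.projectionOntoL_apply_eq_zero_iff h.symm).2 hmem
    rw [map_add, Submodule.projectionOntoL_apply_left] at h0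
    have h1 : β e = -(Es.projectionOntoL N h.symm (e : E)) :=
      eq_neg_of_add_eq_zero_right h0
    simp [h1]

open Classical in
/-- The coordinate operator `α` of a subspace `N` relative to `E = M₀ ⊕ Es`: the unique
`α ∈ B(M₀, Es)` with `N = {e + α e : e ∈ M₀}`. It exists and is unique whenever `N ⊕ Es = E`;
the value `0` in the remaining cases is a placeholder. -/
noncomputable def coordinateOperator (M₀ Es N : Submodule 𝕜 E) : M₀ →L[𝕜] Es :=
  if h : ∃ α : M₀ →L[𝕜] Es, IsCoordinateOperator M₀ Es N α then h.choose else 0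

theorem coordinateOperator_eq_iff {M₀ Es N : Submodule 𝕜 E}
    (h₀ : M₀.IsTopCompl Es) (h : N.IsTopCompl Es) (α : M₀ →L[𝕜] Es) :
    coordinateOperator M₀ Es N = α ↔ IsCoordinateOperator M₀ Es N α := by
  have hu := existsUnique_coordinateOperator h₀ h
  have hs : IsCoordinateOperator M₀ Es N (coordinateOperator M₀ Es N) := by
    rw [coordinateOperator, dif_pos hu.exists]
    exact hu.exists.choose_spec
  exact ⟨fun e => e ▸ hs, fun hα => hu.unique hs hα⟩

end Cofinal

open Topology

/-! ### Velocities of curves in a set -/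

section Tangent

variable {F G : Type*} [NormedAddCommGroup F] [NormedSpace ℝ F]
  [NormedAddCommGroup G] [NormedSpace ℝ G]

/-! Near `x₀` an integral submanifold is the graph of a C¹ map `ψ` from `M₀` to a complement. The
tangent space of that graph at `x + ψ x` is the graph of `ψ'(x)` (`tangentVectors_graph`), so
tangency to `M` says exactly that `ψ'` is the coordinate operator. Given a submanifold, a chart with
derivative `A` at `x₀` shows `M₀ = A⁻¹E₀` (`tangentVectors_eq_comap_of_chart`), which splits with
complement `A⁻¹E₁`; the inverse function theorem then yields `ψ` (`exists_graph_of_chart`).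
Conversely, the graph of a solution `ψ` is a submanifold (`isC1Submanifold_graph`), tangent to `M`
by the differential equation. -/

theorem tangentVectors_mono {S T : Set F} (h : S ⊆ T) (x : F) :
    tangentVectors S x ⊆ tangentVectors T x := by
  rintro v ⟨c, δ, hδ, hc, hS, h0, hv⟩
  exact ⟨c, δ, hδ, hc, fun t ht => h (hS t ht), h0, hv⟩

theorem mem_tangentVectors_of_eventually {S : Set F} {x v : F} {c : ℝ → F}
    (hc : ContDiffAt ℝ 1 c 0) (hS : ∀ᶠ t in 𝓝 0, c t ∈ S) (h0 : c 0 = x)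
    (hv : HasDerivAt c v 0) : v ∈ tangentVectors S x := by
  have hc' : ∀ᶠ t in 𝓝 (0 : ℝ), ContDiffAt ℝ 1 c t := hc.eventually (by simp)
  obtain ⟨δ, hδ, hball⟩ := Metric.eventually_nhds_iff_ball.1 (hc'.and hS)
  rw [Real.ball_eq_Ioo, zero_sub, zero_add] at hball
  exact ⟨c, δ, hδ, fun t ht => (hball t ht).1.contDiffWithinAt, fun t ht => (hball t ht).2, h0, hv⟩

/-- Only the germ of the curve at `0` matters; this form makes restriction and composition free of
interval bookkeeping. -/
theorem mem_tangentVectors_iff {S : Set F} {x v : F} :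
    v ∈ tangentVectors S x ↔ ∃ c : ℝ → F, ContDiffAt ℝ 1 c 0 ∧ (∀ᶠ t in 𝓝 0, c t ∈ S) ∧
      c 0 = x ∧ HasDerivAt c v 0 := by
  constructor
  · rintro ⟨c, δ, hδ, hc, hS, h0, hv⟩
    have hn : Ioo (-δ) δ ∈ 𝓝 (0 : ℝ) := Ioo_mem_nhds (neg_lt_zero.2 hδ) hδ
    exact ⟨c, hc.contDiffAt hn, Filter.mem_of_superset hn hS, h0, hv⟩
  · rintro ⟨c, hc, hS, h0, hv⟩
    exact mem_tangentVectors_of_eventually hc hS h0 hv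

theorem tangentVectors_inter_of_isOpen {S U : Set F} (hU : IsOpen U) {x : F} (hx : x ∈ U) :
    tangentVectors (S ∩ U) x = tangentVectors S x := by
  refine (tangentVectors_mono inter_subset_left x).antisymm fun v hv => ?_
  obtain ⟨c, hc, hS, rfl, hcv⟩ := mem_tangentVectors_iff.1 hv
  exact mem_tangentVectors_iff.2
    ⟨c, hc, hS.and (hc.continuousAt.eventually_mem (hU.mem_nhds hx)), rfl, hcv⟩

theorem map_mem_tangentVectors_image {S : Set F} {x v : F} {f : F → G} {f' : F →L[ℝ] G}
    (hf : ContDiffAt ℝ 1 f x) (hf' : HasFDerivAt f f' x) (hv : v ∈ tangentVectors S x) :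
    f' v ∈ tangentVectors (f '' S) (f x) := by
  obtain ⟨c, hc, hS, rfl, hcv⟩ := mem_tangentVectors_iff.1 hv
  exact mem_tangentVectors_iff.2 ⟨f ∘ c, hf.comp _ hc,
    hS.mono fun t ht => mem_image_of_mem f ht, rfl, hf'.comp_hasDerivAt 0 hcv⟩

end Tangent

/-! ### Splittings and graphs -/

section Splitting

variable {𝕜 : Type*} [RCLike 𝕜] {E : Type*} [NormedAddCommGroup E] [NormedSpace 𝕜 E]

/-- The projection onto `p` along `q` is a continuous left inverse of `e ↦ e + α e`, whose range is
`N`; its kernel `q` therefore complements `N`. -/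
theorem IsCoordinateOperator.isTopCompl {p q N : Submodule 𝕜 E} (h : p.IsTopCompl q)
    {α : p →L[𝕜] q} (hα : IsCoordinateOperator p q N α) : N.IsTopCompl q := by
  have key := ContinuousLinearMap.isTopCompl_range_ker_of_leftInverse
    (p.subtypeL + q.subtypeL.comp α) (p.projectionOntoL q h) (fun e => by
      change p.projectionOntoL q h ((e : E) + (α e : E)) = e
      rw [map_add, Submodule.projectionOntoL_apply_left, Submodule.projectionOntoL_apply_right,
        add_zero])
  rw [Submodule.ker_projectionOntoL] at key
  convert key
  apply SetLike.coe_injective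
  rw [hα]
  ext v
  simp [eq_comm]

theorem Submodule.IsTopCompl.comap_equiv {p q : Submodule 𝕜 E} (h : p.IsTopCompl q)
    (A : E ≃L[𝕜] E) : (p.comap (A : E →ₗ[𝕜] E)).IsTopCompl (q.comap (A : E →ₗ[𝕜] E)) := by
  have key := ContinuousLinearMap.isTopCompl_range_ker_of_leftInverse
    ((A.symm : E →L[𝕜] E).comp p.subtypeL) ((p.projectionOntoL q h).comp (A : E →L[𝕜] E))
    (fun e => by
      change p.projectionOntoL q h (A (A.symm e)) = e
      rw [A.apply_symm_apply, Submodule.projectionOntoL_apply_left])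
  convert key
  · ext v
    constructor
    · intro hv
      exact ⟨⟨A v, hv⟩, A.symm_apply_apply v⟩
    · rintro ⟨e, rfl⟩
      change A (A.symm e) ∈ p
      rw [A.apply_symm_apply]
      exact e.2
  · ext v
    exact (Submodule.projectionOntoL_apply_eq_zero_iff h).symm

variable {p q : Submodule 𝕜 E}

theorem Submodule.IsTopCompl.projectionOntoL_coe_add_coe (h : p.IsTopCompl q) (a : p) (b : q) :
    p.projectionOntoL q h ((a : E) + (b : E)) = a := by
  rw [map_add, projectionOntoL_apply_left, projectionOntoL_apply_right, add_zero]

theorem Submodule.IsTopCompl.projectionOntoL_add_projectionOntoL (h : p.IsTopCompl q) (v : E) :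
    (p.projectionOntoL q h v : E) + (q.projectionOntoL p h.symm v : E) = v :=
  Submodule.projection_add_projection_eq_self h.isCompl v

variable {V : Set p} {ψ : p → q}

/-- The shear `v ↦ v - ψ (P v)` flattens the graph onto `V`. It preserves `P v`, so changing the
sign inverts it. -/
theorem isC1Submanifold_graph (h : p.IsTopCompl q) (hV : IsOpen V) (hψ : ContDiffOn 𝕜 1 ψ V) :
    IsC1Submanifold 𝕜 ((fun x : p => (x : E) + (ψ x : E)) '' V) := by
  rintro _ ⟨x, hx, rfl⟩
  set P := p.projectionOntoL q h with hP
  have hPa : ∀ (a : p) (b : q), P ((a : E) + (b : E)) = a := h.projectionOntoL_coe_add_coe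
  have hPq : ∀ b : q, P (b : E) = 0 := Submodule.projectionOntoL_apply_right h
  have hO : IsOpen (P ⁻¹' V) := hV.preimage P.continuous
  have hsm : ContDiffOn 𝕜 1 (fun v : E => (ψ (P v) : E)) (P ⁻¹' V) :=
    q.subtypeL.contDiff.comp_contDiffOn (hψ.comp P.contDiff.contDiffOn fun _ hv => hv)
  have hm : ContDiffOn 𝕜 1 (fun v : E => v - (ψ (P v) : E)) (P ⁻¹' V) := contDiffOn_id.sub hsm
  have hp : ContDiffOn 𝕜 1 (fun v : E => v + (ψ (P v) : E)) (P ⁻¹' V) := contDiffOn_id.add hsm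
  have hPm : ∀ v, P (v - (ψ (P v) : E)) = P v := fun v => by rw [map_sub, hPq, sub_zero]
  have hPp : ∀ v, P (v + (ψ (P v) : E)) = P v := fun v => by rw [map_add, hPq, add_zero]
  let φ : OpenPartialHomeomorph E E :=
    { toFun := fun v => v - (ψ (P v) : E)
      invFun := fun v => v + (ψ (P v) : E)
      source := P ⁻¹' V
      target := P ⁻¹' V
      map_source' := fun v hv => by rwa [mem_preimage, hPm]
      map_target' := fun v hv => by rwa [mem_preimage, hPp]
      left_inv' := fun v _ => by rw [hPm, sub_add_cancel]
      right_inv' := fun v _ => by rw [hPp, add_sub_cancel_right]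
      open_source := hO
      open_target := hO
      continuousOn_toFun := hm.continuousOn
      continuousOn_invFun := hp.continuousOn }
  refine ⟨p, q, h, φ, ?_, hm, hp, V, hV, ?_⟩
  · change P _ ∈ V
    rwa [hPa]
  · ext w
    constructor
    · rintro ⟨_, ⟨⟨y, hy, rfl⟩, -⟩, rfl⟩
      refine ⟨y, hy, ?_⟩
      change (y : E) = (y : E) + (ψ y : E) - (ψ (P ((y : E) + (ψ y : E))) : E)
      rw [hPa, add_sub_cancel_right]
    · rintro ⟨y, hy, rfl⟩
      refine ⟨(y : E) + (ψ y : E), ⟨⟨y, hy, rfl⟩, ?_⟩, ?_⟩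
      · change P _ ∈ V
        rwa [hPa]
      · change (y : E) + (ψ y : E) - (ψ (P ((y : E) + (ψ y : E))) : E) = y
        rw [hPa, add_sub_cancel_right]

variable [NormedSpace ℝ E] [IsScalarTower ℝ 𝕜 E]

theorem tangentVectors_graph (h : p.IsTopCompl q) (hV : IsOpen V) (hψ : ContDiffOn 𝕜 1 ψ V)
    {x : p} (hx : x ∈ V) {L : p →L[𝕜] q} (hL : HasFDerivAt ψ L x) :
    tangentVectors ((fun x : p => (x : E) + (ψ x : E)) '' V) ((x : E) + (ψ x : E)) =
      {v | ∃ e : p, v = (e : E) + (L e : E)} := by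
  have hF : ContDiffAt 𝕜 1 (fun x : p => (x : E) + (ψ x : E)) x :=
    p.subtypeL.contDiff.contDiffAt.add
      (q.subtypeL.contDiff.contDiffAt.comp x (hψ.contDiffAt (hV.mem_nhds hx)))
  have hF' : HasFDerivAt (fun x : p => (x : E) + (ψ x : E))
      (p.subtypeL + q.subtypeL.comp L) x :=
    p.subtypeL.hasFDerivAt.add (q.subtypeL.hasFDerivAt.comp x hL)
  ext v
  constructor
  · intro hv
    set P := p.projectionOntoL q h with hP
    have hPa : ∀ (a : p) (b : q), P ((a : E) + (b : E)) = a := h.projectionOntoL_coe_add_coe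
    obtain ⟨c, hc, hS, h0, hv⟩ := mem_tangentVectors_iff.1 hv
    refine ⟨P v, ?_⟩
    have hPc : HasDerivAt (fun t => P (c t)) (P v) 0 :=
      (P.restrictScalars ℝ).hasFDerivAt.comp_hasDerivAt 0 hv
    have hPc0 : P (c 0) = x := by rw [h0, hPa]
    have h1 : HasDerivAt (fun t => (P (c t) : E) + (ψ (P (c t)) : E))
        ((P v : E) + (L (P v) : E)) 0 := by
      rw [← hPc0] at hF'
      exact (hF'.restrictScalars ℝ).comp_hasDerivAt 0 hPc
    -- A curve in the graph equals `P c + ψ (P c)` near `0`, so both expressions have the same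
    -- velocity.
    refine hv.unique (h1.congr_of_eventuallyEq (hS.mono ?_))
    rintro t ⟨y, -, hy⟩
    simp only at hy ⊢
    rw [← hy, hPa]
  · rintro ⟨e, rfl⟩
    have hline : HasDerivAt (fun t : ℝ => x + t • e) e 0 := by
      simpa using ((hasDerivAt_id (0 : ℝ)).smul_const e).const_add x
    have he : e ∈ tangentVectors V x := by
      refine mem_tangentVectors_of_eventually (c := fun t : ℝ => x + t • e)
        (by fun_prop) (hline.continuousAt.eventually_mem (hV.mem_nhds (by simpa using hx)))
        (by simp) hline
    exact map_mem_tangentVectors_image (hF.restrict_scalars ℝ) (hF'.restrictScalars ℝ) he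

theorem tangentVectors_image_coe (h : p.IsTopCompl q) (hV : IsOpen V) {x : p} (hx : x ∈ V) :
    tangentVectors ((fun x : p => (x : E)) '' V) x = p := by
  have key := tangentVectors_graph h hV (ψ := 0) contDiffOn_const hx (L := 0)
    (hasFDerivAt_const _ _)
  simp only [Pi.zero_apply, ZeroMemClass.coe_zero, add_zero, zero_apply] at key
  rw [key]
  ext v
  exact ⟨fun ⟨e, he⟩ => he ▸ e.2, fun hv => ⟨⟨v, hv⟩, rfl⟩⟩

end Splitting

/-! ### From charts to graphs -/

section Charts

variable {𝕜 : Type*} [RCLike 𝕜] {E : Type*} [NormedAddCommGroup E] [NormedSpace 𝕜 E]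

theorem OpenPartialHomeomorph.exists_hasFDerivAt_equiv {φ : OpenPartialHomeomorph E E}
    (hφ : ContDiffOn 𝕜 1 φ φ.source) (hφ' : ContDiffOn 𝕜 1 φ.symm φ.target) {x : E}
    (hx : x ∈ φ.source) :
    ∃ A : E ≃L[𝕜] E, HasFDerivAt φ (A : E →L[𝕜] E) x ∧
      HasFDerivAt φ.symm (A.symm : E →L[𝕜] E) (φ x) := by
  have h1 : HasFDerivAt φ (fderiv 𝕜 φ x) x :=
    ((hφ.contDiffAt (φ.open_source.mem_nhds hx)).differentiableAt one_ne_zero).hasFDerivAt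
  have hx' := φ.map_source hx
  have h2 : HasFDerivAt φ.symm (fderiv 𝕜 φ.symm (φ x)) (φ x) :=
    ((hφ'.contDiffAt (φ.open_target.mem_nhds hx')).differentiableAt one_ne_zero).hasFDerivAt
  have h21 : (fderiv 𝕜 φ.symm (φ x)).comp (fderiv 𝕜 φ x) = ContinuousLinearMap.id 𝕜 E :=
    (h2.comp x h1).unique ((hasFDerivAt_id x).congr_of_eventuallyEq
      (φ.eventually_left_inverse hx))
  have h12 : (fderiv 𝕜 φ x).comp (fderiv 𝕜 φ.symm (φ x)) = ContinuousLinearMap.id 𝕜 E := by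
    rw [← φ.left_inv hx] at h1
    have := (h1.comp (φ x) h2).unique ((hasFDerivAt_id (φ x)).congr_of_eventuallyEq
      (φ.eventually_right_inverse hx'))
    rwa [φ.left_inv hx] at this
  exact ⟨ContinuousLinearEquiv.equivOfInverse _ _ (fun v => DFunLike.congr_fun h21 v)
    (fun v => DFunLike.congr_fun h12 v), h1, h2⟩

variable {S : Set E} {E₀ E₁ : Submodule 𝕜 E} {φ : OpenPartialHomeomorph E E} {W : Set E₀}
  {x : E} {A : E ≃L[𝕜] E}

/-- Curves are carried by `φ` and `φ.symm` between `S` and an open piece of `E₀`, where all of `E₀`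
is tangent. -/
theorem tangentVectors_eq_comap_of_chart [NormedSpace ℝ E] [IsScalarTower ℝ 𝕜 E]
    (h : E₀.IsTopCompl E₁) (hφ : ContDiffOn 𝕜 1 φ φ.source) (hφ' : ContDiffOn 𝕜 1 φ.symm φ.target)
    (hW : IsOpen W) (hSW : φ '' (S ∩ φ.source) = (fun w : E₀ => (w : E)) '' W)
    (hxS : x ∈ S) (hx : x ∈ φ.source) (hA : HasFDerivAt φ (A : E →L[𝕜] E) x)
    (hA' : HasFDerivAt φ.symm (A.symm : E →L[𝕜] E) (φ x)) :
    tangentVectors S x = E₀.comap (A : E →ₗ[𝕜] E) := by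
  obtain ⟨w, hw, hwx⟩ : φ x ∈ (fun w : E₀ => (w : E)) '' W :=
    hSW ▸ mem_image_of_mem φ ⟨hxS, hx⟩
  have hE₀ : tangentVectors (φ '' (S ∩ φ.source)) (φ x) = E₀ := by
    rw [hSW, ← hwx, tangentVectors_image_coe h hW hw]
  rw [← tangentVectors_inter_of_isOpen φ.open_source hx]
  have hc := (hφ.contDiffAt (φ.open_source.mem_nhds hx)).restrict_scalars ℝ
  have hc' := (hφ'.contDiffAt (φ.open_target.mem_nhds (φ.map_source hx))).restrict_scalars ℝ
  ext v
  constructor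
  · intro hv
    have := map_mem_tangentVectors_image hc (hA.restrictScalars ℝ) hv
    rwa [hE₀] at this
  · intro hv
    have hv' : A v ∈ tangentVectors (φ '' (S ∩ φ.source)) (φ x) := hE₀ ▸ hv
    have := map_mem_tangentVectors_image hc' (hA'.restrictScalars ℝ) hv'
    have himage : φ.symm '' (φ '' (S ∩ φ.source)) = S ∩ φ.source :=
      φ.toPartialEquiv.symm_image_image_of_subset_source inter_subset_right
    rw [φ.left_inv hx, himage] at this
    simpa using this

/-- The parametrization `φ.symm` of `S` by `W`, projected to `p`, has an invertible derivative since
`A⁻¹` maps `E₀` onto `p`. Inverting it locally uses the `p`-component as parameter; the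
`q`-component is then `ψ`. -/
theorem exists_graph_of_chart [CompleteSpace E] {p q : Submodule 𝕜 E} (hpq : p.IsTopCompl q)
    (h : E₀.IsTopCompl E₁) (hφ' : ContDiffOn 𝕜 1 φ.symm φ.target)
    (hW : IsOpen W) (hSW : φ '' (S ∩ φ.source) = (fun w : E₀ => (w : E)) '' W)
    (hxS : x ∈ S) (hx : x ∈ φ.source)
    (hA' : HasFDerivAt φ.symm (A.symm : E →L[𝕜] E) (φ x))
    (hp : p = E₀.comap (A : E →ₗ[𝕜] E)) :
    ∃ (V : Set p) (ψ : p → q) (U : Set E), IsOpen V ∧ p.projectionOntoL q hpq x ∈ V ∧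
      ContDiffOn 𝕜 1 ψ V ∧ IsOpen U ∧
      S ∩ U = (fun y : p => (y : E) + (ψ y : E)) '' V ∧ x ∈ U := by
  set P := p.projectionOntoL q hpq with hP
  set Q := q.projectionOntoL p hpq.symm with hQ
  have hPQ : ∀ v, (P v : E) + (Q v : E) = v := hpq.projectionOntoL_add_projectionOntoL
  have hPp : ∀ a : p, P (a : E) = a := Submodule.projectionOntoL_apply_left hpq
  set P₀ := E₀.projectionOntoL E₁ h with hP₀
  have hP₀e : ∀ a : E₀, P₀ (a : E) = a := Submodule.projectionOntoL_apply_left h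
  have := h.isClosed.completeSpace_coe
  have hmem : ∀ v, v ∈ p ↔ A v ∈ E₀ := fun v => by rw [hp]; rfl
  obtain ⟨w, hw, hwx⟩ : φ x ∈ (fun w : E₀ => (w : E)) '' W :=
    hSW ▸ mem_image_of_mem φ ⟨hxS, hx⟩
  simp only at hwx
  have hWt : ∀ w ∈ W, (w : E) ∈ φ.target ∧ φ.symm w ∈ S := by
    intro w hw
    obtain ⟨y, ⟨hyS, hy⟩, hyw⟩ : (w : E) ∈ φ '' (S ∩ φ.source) := hSW ▸ mem_image_of_mem _ hw
    rw [← hyw, φ.left_inv hy]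
    exact ⟨φ.map_source hy, hyS⟩
  let B : E₀ ≃L[𝕜] p := ContinuousLinearEquiv.equivOfInverse
    (P.comp ((A.symm : E →L[𝕜] E).comp E₀.subtypeL))
    (P₀.comp ((A : E →L[𝕜] E).comp p.subtypeL))
    (fun e => by
      have he : A.symm (e : E) ∈ p := by rw [hmem, A.apply_symm_apply]; exact e.2
      change P₀ (A (P (A.symm (e : E)) : E)) = e
      rw [hPp ⟨_, he⟩, A.apply_symm_apply, hP₀e])
    (fun e => by
      change P (A.symm (P₀ (A (e : E)) : E)) = e
      rw [hP₀e ⟨_, (hmem _).1 e.2⟩, A.symm_apply_apply, hPp])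
  let f : E₀ → p := fun w => P (φ.symm w)
  have hgc : ∀ w ∈ W, ContDiffAt 𝕜 1 (fun w : E₀ => φ.symm w) w := fun w hw =>
    (hφ'.contDiffAt (φ.open_target.mem_nhds (hWt w hw).1)).comp w E₀.subtypeL.contDiff.contDiffAt
  have hf : ContDiffAt 𝕜 1 f w := P.contDiff.contDiffAt.comp w (hgc w hw)
  have hfB : HasFDerivAt f (B : E₀ →L[𝕜] p) w := by
    rw [← hwx] at hA'
    exact P.hasFDerivAt.comp w (hA'.comp w E₀.subtypeL.hasFDerivAt)
  let Φ := hf.toOpenPartialHomeomorph f hfB one_ne_zero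
  have hwΦ : w ∈ Φ.source := hf.mem_toOpenPartialHomeomorph_source hfB one_ne_zero
  have hfw : f w ∈ Φ.target := Φ.map_source hwΦ
  have hsymm : ∀ᶠ y in 𝓝 (f w), ContDiffAt 𝕜 1 Φ.symm y :=
    (hf.to_localInverse hfB one_ne_zero).eventually (by simp)
  have hsW : ∀ᶠ y in 𝓝 (f w), Φ.symm y ∈ W :=
    (Φ.symm.continuousAt hfw).eventually_mem
      (by rw [show Φ.symm (f w) = w from Φ.left_inv hwΦ]; exact hW.mem_nhds hw)
  -- `V` is shrunk so that at each of its points the local inverse is C¹ and lands in `W`.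
  obtain ⟨V, hV, hVo, hwV⟩ := eventually_nhds_iff.1
    ((hsymm.and hsW).and (Φ.open_target.mem_nhds hfw))
  have hfwx : f w = P x := by
    change P (φ.symm w) = P x
    rw [hwx, φ.left_inv hx]
  have hval : ∀ y ∈ V, P (φ.symm (Φ.symm y)) = y := fun y hy => Φ.right_inv (hV y hy).2
  have hgraph : ∀ y ∈ V, (y : E) + (Q (φ.symm (Φ.symm y)) : E) = φ.symm (Φ.symm y) := by
    intro y hy
    have := hPQ (φ.symm (Φ.symm y))
    rwa [hval y hy] at this
  have hO : IsOpen (W ∩ (Φ.source ∩ Φ ⁻¹' V)) := hW.inter (Φ.isOpen_inter_preimage hVo)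
  -- The parameter set is open only in `E₀`. Extending it to an open `O` of `E` gives an open `U`
  -- that cuts from `S` exactly the graph over `V`.
  obtain ⟨O, hOo, hOW⟩ := Topology.IsInducing.subtypeVal.isOpen_iff.1 hO
  have hmemO : ∀ u : E₀, (u : E) ∈ O ↔ u ∈ W ∩ (Φ.source ∩ Φ ⁻¹' V) := Set.ext_iff.1 hOW
  refine ⟨V, fun y => Q (φ.symm (Φ.symm y)), φ.source ∩ φ ⁻¹' O, hVo, hfwx ▸ hwV, ?_,
    φ.isOpen_inter_preimage hOo, ?_, hx, ?_⟩
  · intro y hy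
    exact (Q.contDiff.contDiffAt.comp y
      ((hgc _ (hV y hy).1.2).comp y (hV y hy).1.1)).contDiffWithinAt
  · ext z
    constructor
    · rintro ⟨hzS, hz, hzO⟩
      obtain ⟨u, hu, huz⟩ : φ z ∈ (fun w : E₀ => (w : E)) '' W :=
        hSW ▸ mem_image_of_mem φ ⟨hzS, hz⟩
      simp only at huz
      obtain ⟨-, huΦ, huV⟩ := (hmemO u).1 (huz ▸ hzO)
      refine ⟨Φ u, huV, ?_⟩
      simp only
      rw [hgraph _ huV, Φ.left_inv huΦ, huz, φ.left_inv hz]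
    · rintro ⟨y, hy, rfl⟩
      simp only
      rw [hgraph y hy]
      obtain ⟨⟨-, hyW⟩, hyt⟩ := hV y hy
      obtain ⟨ht, hS⟩ := hWt _ hyW
      refine ⟨hS, φ.map_target ht, ?_⟩
      rw [mem_preimage, φ.right_inv ht]
      exact (hmemO _).2
        ⟨hyW, Φ.map_target hyt, by rw [mem_preimage, Φ.right_inv hyt]; exact hy⟩
  · rw [mem_preimage, ← hwx]
    exact (hmemO w).2 ⟨hw, hwΦ, hwV⟩

end Charts

/-! ### The Frobenius theorem -/

theorem theorem2p2 {𝕜 : Type*} [RCLike 𝕜] {E : Type*} [NormedAddCommGroup E]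
    [NormedSpace 𝕜 E] [NormedSpace ℝ E] [IsScalarTower ℝ 𝕜 E] [CompleteSpace E]
    (Λ : Set E) (hΛ : IsOpen Λ) (M : E → Submodule 𝕜 E) (x₀ : E) (hx₀ : x₀ ∈ Λ) :
    C1IntegrableAt 𝕜 Λ M x₀ ↔
      ∃ (Es : Submodule 𝕜 E) (hEs : (M x₀).IsTopCompl Es)
        (V : Set (M x₀)) (ψ : M x₀ → Es),
        IsOpen V ∧ (M x₀).projectionOntoL Es hEs x₀ ∈ V ∧
        ContDiffOn 𝕜 1 ψ V ∧
        (∀ x ∈ V, (x : E) + (ψ x : E) ∈ cofinalSet Λ M Es) ∧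
        ContinuousOn
          (fun x : M x₀ => coordinateOperator (M x₀) Es (M ((x : E) + (ψ x : E)))) V ∧
        (∀ x ∈ V, HasFDerivAt ψ
          (coordinateOperator (M x₀) Es (M ((x : E) + (ψ x : E)))) x) ∧
        ψ ((M x₀).projectionOntoL Es hEs x₀) = Es.projectionOntoL (M x₀) hEs.symm x₀ := by
  constructor
  · rintro ⟨S, hxS, hSΛ, hS, hM⟩
    obtain ⟨E₀, E₁, h, φ, hx, hφ, hφ', W, hW, hSW⟩ := hS x₀ hxS
    obtain ⟨A, hA, hA'⟩ := φ.exists_hasFDerivAt_equiv hφ hφ' hx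
    have hp : M x₀ = E₀.comap (A : E →ₗ[𝕜] E) := SetLike.coe_injective <|
      (hM x₀ hxS).trans (tangentVectors_eq_comap_of_chart h hφ hφ' hW hSW hxS hx hA hA')
    have hpq : (M x₀).IsTopCompl (E₁.comap (A : E →ₗ[𝕜] E)) := by
      rw [hp]
      exact h.comap_equiv A
    obtain ⟨V, ψ, U, hV, hxV, hψ, hU, hSU, hxU⟩ :=
      exists_graph_of_chart hpq h hφ' hW hSW hxS hx hA' hp
    have hmem : ∀ y ∈ V, (y : E) + (ψ y : E) ∈ S ∩ U := fun y hy => hSU ▸ mem_image_of_mem _ hy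
    have hd : ∀ y ∈ V, HasFDerivAt ψ (fderiv 𝕜 ψ y) y := fun y hy =>
      ((hψ.contDiffAt (hV.mem_nhds hy)).differentiableAt one_ne_zero).hasFDerivAt
    have hco : ∀ y ∈ V, IsCoordinateOperator (M x₀) (E₁.comap (A : E →ₗ[𝕜] E))
        (M ((y : E) + (ψ y : E))) (fderiv 𝕜 ψ y) := by
      intro y hy
      rw [IsCoordinateOperator, hM _ (hmem y hy).1,
        ← tangentVectors_inter_of_isOpen hU (hmem y hy).2, hSU,
        tangentVectors_graph hpq hV hψ hy (hd y hy)]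
    have hα : ∀ y ∈ V, coordinateOperator (M x₀) (E₁.comap (A : E →ₗ[𝕜] E))
        (M ((y : E) + (ψ y : E))) = fderiv 𝕜 ψ y := fun y hy =>
      (coordinateOperator_eq_iff hpq ((hco y hy).isTopCompl hpq) _).2 (hco y hy)
    refine ⟨_, hpq, V, ψ, hV, hxV, hψ,
      fun y hy => ⟨hSΛ (hmem y hy).1, (hco y hy).isTopCompl hpq⟩,
      (hψ.continuousOn_fderiv_of_isOpen hV le_rfl).congr hα,
      fun y hy => (hα y hy).symm ▸ hd y hy, ?_⟩
    -- The initial condition: `x₀` lies on the graph, so its two components are `y` and `ψ y`.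
    obtain ⟨y, -, hy⟩ : x₀ ∈ (fun y : M x₀ => (y : E) + (ψ y : E)) '' V := hSU ▸ ⟨hxS, hxU⟩
    simp only at hy
    have h1 := hpq.projectionOntoL_coe_add_coe y (ψ y)
    have h2 := hpq.symm.projectionOntoL_coe_add_coe (ψ y) y
    rw [add_comm, hy] at h2
    rw [hy] at h1
    rw [h1, h2]
  · rintro ⟨Es, hEs, V, ψ, hV, hxV, hψ, hJ, -, hd, hψx⟩
    refine ⟨(fun y : M x₀ => (y : E) + (ψ y : E)) '' V, ⟨_, hxV, ?_⟩, ?_,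
      isC1Submanifold_graph hEs hV hψ, ?_⟩
    · simp only
      rw [hψx]
      exact hEs.projectionOntoL_add_projectionOntoL x₀
    · rintro _ ⟨y, hy, rfl⟩
      exact (hJ y hy).1
    · rintro _ ⟨y, hy, rfl⟩
      rw [tangentVectors_graph hEs hV hψ hy (hd y hy)]
      exact (coordinateOperator_eq_iff hEs (hJ y hy).2 _).1 rfl
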